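/- A qubit channel is a completely positive, trace preserving linear map $\Phi:\mathcal M_2(\mathbb C)\to\mathcal M_2(\mathbb C)$; the qubit channels form a convex set, and $\Phi$ is called extremal if it is an extreme point of this set. Let $T_\Phi$ be the real $4\times4$ matrix of $\Phi$ in the Pauli basis, $(T_\Phi)_{ij}=\frac12\operatorname{tr}(\sigma_i\Phi(\sigma_j))$, $0\le i,j\le 3$, with $\sigma_0=I_2$; $\Phi$ is non-degenerate if $\det T_\Phi\neq0$. The pure output of $\Phi$ is the set of pure states (density matrices of rank one) in the image under $\Phi$ of the set of density matrices. A non-degenerate extremal 1PO channel is a non-degenerate extremal channel whose pure output consists of exactly one state. A unitary conjugation is a channel $\Phi_U(X)=UXU^\dagger$ with $U$ a unitary $2\times 2$ matrix. Proposition. Let $\Phi$ be a non-degenerate extremal 1PO channel and let $\Phi=\Phi_2\circ\Phi_1$ with arbitrary qubit channels $\Phi_1,\Phi_2$. Then each of $\Phi_1$ and $\Phi_2$ is either a unitary conjugation or a non-degenerate extremal 1PO channel, and they are not both unitary conjugations. Moreover, each factor $\Phi_i$ that is not a unitary conjugation is, up to unitary conjugations, in normal form: there are unitary matrices $U,V$,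 a number $\lambda\in(0,1)$ and a channel $\Psi$ with $$\Phi_i=\Phi_U\circ\Psi\circ\Phi_V,\qquad T_\Psi=\begin{pmatrix}1&0&0&0\\0&\lambda&0&0\\0&0&\lambda&0\\1-\lambda^2&0&0&\lambda^2\end{pmatrix}.$$ -/

import Mathlib

open scoped ComplexOrder

namespace QubitChannel

/-- The space `M₂(ℂ)`. -/
abbrev Mat2 : Type := Matrix (Fin 2) (Fin 2) ℂ

/-- The map `Φ ⊗ id_k` on `M₂(ℂ) ⊗ M_k(ℂ)`, where an element of the tensor product is written as a
matrix indexed by `Fin 2 × Fin k`. It applies `Φ` to each of the `k × k` blocks in `M₂(ℂ)`. -/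
def ampliation (Φ : Mat2 →ₗ[ℂ] Mat2) (k : ℕ) (X : Matrix (Fin 2 × Fin k) (Fin 2 × Fin k) ℂ) :
    Matrix (Fin 2 × Fin k) (Fin 2 × Fin k) ℂ :=
  Matrix.of fun p q => Φ (Matrix.of fun i j => X (i, p.2) (j, q.2)) p.1 q.1

/-- Complete positivity: every `Φ ⊗ id_k` preserves positive semidefiniteness. -/
def IsCompletelyPositive (Φ : Mat2 →ₗ[ℂ] Mat2) : Prop :=
  ∀ (k : ℕ) (X : Matrix (Fin 2 × Fin k) (Fin 2 × Fin k) ℂ),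
    X.PosSemidef → (ampliation Φ k X).PosSemidef

/-- The set of qubit channels: completely positive trace preserving linear maps on `M₂(ℂ)`. -/
def channels : Set (Mat2 →ₗ[ℂ] Mat2) :=
  {Φ | IsCompletelyPositive Φ ∧ ∀ X : Mat2, (Φ X).trace = X.trace}

/-- Density matrices: positive semidefinite matrices of trace one. -/
def densityMatrices : Set Mat2 := {ρ | ρ.PosSemidef ∧ ρ.trace = 1}

/-- Pure states: density matrices of rank one. -/
def pureStates : Set Mat2 := {ρ | ρ ∈ densityMatrices ∧ ρ.rank = 1}

/-- The pure output of a channel: the pure states in the image of the set of states. -/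
def pureOutput (Φ : Mat2 →ₗ[ℂ] Mat2) : Set Mat2 := (Φ '' densityMatrices) ∩ pureStates

/-- The unitary conjugation `X ↦ U X Uᴴ`. -/
def unitaryConj (U : Matrix.unitaryGroup (Fin 2) ℂ) : Mat2 →ₗ[ℂ] Mat2 :=
  LinearMap.mulLeft ℂ (U : Mat2) ∘ₗ LinearMap.mulRight ℂ (U : Mat2).conjTranspose

/-- `Φ` is a unitary conjugation. -/
def IsUnitaryConj (Φ : Mat2 →ₗ[ℂ] Mat2) : Prop :=
  ∃ U : Matrix.unitaryGroup (Fin 2) ℂ, Φ = unitaryConj U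

/-- The matrices `σ₀ = I₂, σ₁ = σ_x, σ₂ = σ_y, σ₃ = σ_z`. -/
def pauli : Fin 4 → Mat2 :=
  ![1, !![0, 1; 1, 0], !![0, -Complex.I; Complex.I, 0], !![1, 0; 0, -1]]

/-- The real `4 × 4` matrix of a channel in the Pauli basis: if `ρ = ½ ∑ rⱼ σⱼ`, then
`Φ ρ = ½ ∑ r'ᵢ σᵢ` with `r' = T r`, so `Tᵢⱼ = ½ tr (σᵢ Φ(σⱼ))`. These traces are real for every
channel. -/
noncomputable def blochMatrix (Φ : Mat2 →ₗ[ℂ] Mat2) : Matrix (Fin 4) (Fin 4) ℝ :=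
  Matrix.of fun i j => ((pauli i * Φ (pauli j)).trace).re / 2

/-- A channel is non-degenerate if the determinant of its matrix in the Pauli basis is non-zero. -/
def IsNondegenerate (Φ : Mat2 →ₗ[ℂ] Mat2) : Prop := (blochMatrix Φ).det ≠ 0

/-- `Φ` is an extreme point of the convex set of qubit channels. -/
def IsExtremal (Φ : Mat2 →ₗ[ℂ] Mat2) : Prop := Φ ∈ Set.extremePoints ℝ channels

/-- Non-degenerate extremal channels with exactly one pure output. -/
def IsNondegenerateExtremalOnePO (Φ : Mat2 →ₗ[ℂ] Mat2) : Prop :=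
  IsExtremal Φ ∧ IsNondegenerate Φ ∧ ∃ ξ : Mat2, pureOutput Φ = {ξ}

/-- The matrix in the Pauli basis of the channel with translation vector `(0, 0, 1 - l²)` and
signed singular values `(l, l, l²)`. -/
def onePOMatrix (l : ℝ) : Matrix (Fin 4) (Fin 4) ℝ :=
  !![1, 0, 0, 0;
     0, l, 0, 0;
     0, 0, l, 0;
     1 - l ^ 2, 0, 0, l ^ 2]

/-- Up to unitary conjugations before and after it, `Φ` is a channel in the one-parameter family
with translation vector `(0, 0, 1 - l²)` and signed singular values `(l, l, l²)`, `0 < l < 1`. -/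
def HasOnePONormalForm (Φ : Mat2 →ₗ[ℂ] Mat2) : Prop :=
  ∃ (U V : Matrix.unitaryGroup (Fin 2) ℂ) (l : ℝ) (Ψ : Mat2 →ₗ[ℂ] Mat2),
    Ψ ∈ channels ∧ 0 < l ∧ l < 1 ∧ blochMatrix Ψ = onePOMatrix l ∧
      Φ = unitaryConj U ∘ₗ Ψ ∘ₗ unitaryConj V

end QubitChannel

namespace QubitChannel

open Matrix Complex

/-! Non-degeneracy passes to both factors and makes them injective, and an injective channel maps
only pure states to pure states (`det_eq_zero_of_map`). So a preimage `ρ` of the pure output `ξ`,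
the intermediate state `Φ₁ ρ` and `ξ` are all pure, and unitary conjugations turn all three into
`groundState`. Both factors then take the form `fixing c q p`, where positivity of the Choi matrix
means `p ≥ 0`, `r = 1 - p - |c|² ≥ 0` and `|q|² ≤ p r` (`exists_eq_fixing`).

Extremality with a single pure output forces the defect `r` to vanish
(`eq_one_sub_normSq_of_isExtremal`): if `r > 0`, either `q` can be moved both ways, or a second pure
output appears. For a composition the defect is `r₂ (1 - p₁) + |c₂|² r₁`. Both terms are nonnegative
with positive coefficients, so `r₁ = r₂ = 0`, hence `q₁ = q₂ = 0`, and both factors are amplitude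
damping channels. Such a channel is a unitary conjugation if `|c| = 1` and has the normal form with
`λ = |c|` if `0 < |c| < 1`. -/

/-! ### Channels and complete positivity -/

/-- The map `X ↦ K X Kᴴ`. -/
def krausMap (K : Mat2) : Mat2 →ₗ[ℂ] Mat2 :=
  LinearMap.mulLeft ℂ K ∘ₗ LinearMap.mulRight ℂ Kᴴ

lemma krausMap_apply (K X : Mat2) : krausMap K X = K * (X * Kᴴ) := rfl

lemma isCompletelyPositive_krausMap (K : Mat2) : IsCompletelyPositive (krausMap K) := by
  intro k X hX
  -- `L` is `K ⊗ 1`.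
  let L : Matrix (Fin 2 × Fin k) (Fin 2 × Fin k) ℂ :=
    Matrix.of fun p q => if p.2 = q.2 then K p.1 q.1 else 0
  have h : ampliation (krausMap K) k X = L * X * Lᴴ := by
    ext ⟨i, a⟩ ⟨j, b⟩
    simp [ampliation, krausMap_apply, L, Matrix.mul_apply, Fintype.sum_prod_type, ite_mul, apply_ite]
    ring
  rw [h]
  exact hX.mul_mul_conjTranspose_same L

lemma IsCompletelyPositive.add {Φ Ψ : Mat2 →ₗ[ℂ] Mat2} (hΦ : IsCompletelyPositive Φ)
    (hΨ : IsCompletelyPositive Ψ) : IsCompletelyPositive (Φ + Ψ) := fun k X hX =>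
  (hΦ k X hX).add (hΨ k X hX)

lemma comp_mem_channels {Φ Ψ : Mat2 →ₗ[ℂ] Mat2} (hΦ : Φ ∈ channels) (hΨ : Ψ ∈ channels) :
    Φ ∘ₗ Ψ ∈ channels :=
  ⟨fun k X hX => hΦ.1 k _ (hΨ.1 k X hX), fun X => (hΦ.2 _).trans (hΨ.2 X)⟩

/-- The Choi matrix of a linear map. -/
def choi (Φ : Mat2 →ₗ[ℂ] Mat2) : Matrix (Fin 2 × Fin 2) (Fin 2 × Fin 2) ℂ :=
  Matrix.of fun a b => Φ (Matrix.single a.2 b.2 1) a.1 b.1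

lemma IsCompletelyPositive.choi_posSemidef {Φ : Mat2 →ₗ[ℂ] Mat2} (h : IsCompletelyPositive Φ) :
    (choi Φ).PosSemidef := by
  -- The vector is the unnormalised maximally entangled one; the blocks of its projector are the
  -- matrix units.
  have := h 2 _ (posSemidef_vecMulVec_self_star
    (fun a : Fin 2 × Fin 2 => if a.1 = a.2 then (1 : ℂ) else 0))
  convert this using 1
  ext ⟨i, k⟩ ⟨j, l⟩
  simp only [choi, ampliation, Matrix.of_apply]
  refine congrArg (fun Y => Φ Y i j) ?_
  ext a b
  fin_cases k <;> fin_cases l <;> fin_cases a <;> fin_cases b <;>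
    simp [Matrix.single, vecMulVec_apply]

lemma apply_eq_sum (Φ : Mat2 →ₗ[ℂ] Mat2) (X : Mat2) :
    Φ X = ∑ k, ∑ l, X k l • Φ (Matrix.single k l 1) := by
  conv_lhs => rw [Matrix.matrix_eq_sum_single X]
  simp only [map_sum]
  refine Finset.sum_congr rfl fun k _ => Finset.sum_congr rfl fun l _ => ?_
  rw [← map_smul]
  simp

lemma IsCompletelyPositive.map_conjTranspose {Φ : Mat2 →ₗ[ℂ] Mat2} (h : IsCompletelyPositive Φ)
    (X : Mat2) : Φ Xᴴ = (Φ X)ᴴ := by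
  have key (k l : Fin 2) : Φ (Matrix.single l k 1) = (Φ (Matrix.single k l 1))ᴴ := by
    ext i j
    exact (h.choi_posSemidef.1.apply (i, l) (j, k)).symm
  rw [apply_eq_sum Φ X, apply_eq_sum Φ Xᴴ]
  simp only [Fin.sum_univ_two, conjTranspose_add, conjTranspose_smul, ← key, conjTranspose_apply]
  abel

/-- This is the ampliation with `k = 1`. -/
lemma IsCompletelyPositive.map_posSemidef {Φ : Mat2 →ₗ[ℂ] Mat2} (h : IsCompletelyPositive Φ)
    {X : Mat2} (hX : X.PosSemidef) : (Φ X).PosSemidef :=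
  (h 1 _ (hX.submatrix Prod.fst)).submatrix fun i => (i, 0)

lemma map_mem_densityMatrices {Φ : Mat2 →ₗ[ℂ] Mat2} (hΦ : Φ ∈ channels) {ρ : Mat2}
    (hρ : ρ ∈ densityMatrices) : Φ ρ ∈ densityMatrices :=
  ⟨hΦ.1.map_posSemidef hρ.1, (hΦ.2 ρ).trans hρ.2⟩

/-! ### Unitary conjugations -/

lemma unitaryConj_apply (U : unitaryGroup (Fin 2) ℂ) (X : Mat2) :
    unitaryConj U X = U * (X * (U : Mat2)ᴴ) := rfl

lemma unitaryConj_mem_channels (U : unitaryGroup (Fin 2) ℂ) : unitaryConj U ∈ channels := by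
  refine ⟨isCompletelyPositive_krausMap U, fun X => ?_⟩
  rw [unitaryConj_apply, Matrix.trace_mul_comm, Matrix.mul_assoc, ← star_eq_conjTranspose,
    Unitary.coe_star_mul_self, mul_one]

lemma unitaryConj_comp (U V : unitaryGroup (Fin 2) ℂ) :
    unitaryConj U ∘ₗ unitaryConj V = unitaryConj (U * V) := by
  ext1 X
  simp [unitaryConj_apply, Matrix.mul_assoc]

lemma unitaryConj_one : unitaryConj 1 = LinearMap.id := by
  ext1 X
  simp [unitaryConj_apply]

lemma unitaryConj_star_comp (U : unitaryGroup (Fin 2) ℂ) :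
    unitaryConj (star U) ∘ₗ unitaryConj U = LinearMap.id := by
  rw [unitaryConj_comp, Unitary.star_mul_self, unitaryConj_one]

lemma unitaryConj_comp_star (U : unitaryGroup (Fin 2) ℂ) :
    unitaryConj U ∘ₗ unitaryConj (star U) = LinearMap.id := by
  rw [unitaryConj_comp, Unitary.mul_star_self, unitaryConj_one]

lemma unitaryConj_star_apply (U : unitaryGroup (Fin 2) ℂ) (X : Mat2) :
    unitaryConj (star U) (unitaryConj U X) = X :=
  LinearMap.congr_fun (unitaryConj_star_comp U) X

lemma unitaryConj_apply_star (U : unitaryGroup (Fin 2) ℂ) (X : Mat2) :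
    unitaryConj U (unitaryConj (star U) X) = X :=
  LinearMap.congr_fun (unitaryConj_comp_star U) X

lemma det_unitaryConj (U : unitaryGroup (Fin 2) ℂ) (X : Mat2) :
    (unitaryConj U X).det = X.det := by
  have h : (U : Mat2).det * ((U : Mat2)ᴴ).det = 1 := by
    rw [← det_mul, ← star_eq_conjTranspose, mem_unitaryGroup_iff.1 U.2, det_one]
  rw [unitaryConj_apply, det_mul, det_mul, mul_left_comm, h, mul_one]

/-! ### Density matrices and pure states -/

/-- The pure state of the first basis vector. -/
def groundState : Mat2 := !![1, 0; 0, 0]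

lemma exists_eq_unitaryConj {ρ : Mat2} (hρ : ρ ∈ densityMatrices) :
    ∃ (U : unitaryGroup (Fin 2) ℂ) (a : ℝ), 0 < a ∧ a ≤ 1 ∧
      ρ = unitaryConj U !![(a : ℂ), 0; 0, ((1 - a : ℝ) : ℂ)] := by
  obtain ⟨hpos, htr⟩ := hρ
  have hspec := hpos.1.spectral_theorem
  have h0 := hpos.eigenvalues_nonneg 0
  have h1 := hpos.eigenvalues_nonneg 1
  have hsum : hpos.1.eigenvalues 0 + hpos.1.eigenvalues 1 = 1 := by
    have := hpos.1.trace_eq_sum_eigenvalues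
    rw [htr, Fin.sum_univ_two] at this
    exact Complex.ofReal_injective (by push_cast; exact this.symm)
  have hρ : ρ = unitaryConj hpos.1.eigenvectorUnitary
      !![(hpos.1.eigenvalues 0 : ℂ), 0; 0, (hpos.1.eigenvalues 1 : ℂ)] := by
    conv_lhs => rw [hspec]
    rw [Unitary.conjStarAlgAut_apply, unitaryConj_apply, Matrix.mul_assoc]
    congr 2
    ext i j
    fin_cases i <;> fin_cases j <;> simp
  rcases h0.lt_or_eq with h | h
  · refine ⟨hpos.1.eigenvectorUnitary, hpos.1.eigenvalues 0, h, by linarith, ?_⟩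
    rwa [← eq_sub_iff_add_eq'.2 hsum]
  -- If the first eigenvalue is zero, the swap `S` moves the eigenvalue `1` to the front, which
  -- keeps `a` positive.
  · let S : unitaryGroup (Fin 2) ℂ := ⟨!![0, 1; 1, 0], by
      rw [mem_unitaryGroup_iff]
      ext i j
      fin_cases i <;> fin_cases j <;> simp [Matrix.mul_apply, Matrix.star_apply]⟩
    refine ⟨hpos.1.eigenvectorUnitary * S, 1, one_pos, le_rfl, ?_⟩
    rw [← unitaryConj_comp, LinearMap.comp_apply]
    conv_lhs => rw [hρ]
    congr 1
    have h1' : hpos.1.eigenvalues 1 = 1 := by linarith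
    rw [← h, h1', unitaryConj_apply]
    ext i j
    fin_cases i <;> fin_cases j <;> simp [S, Matrix.mul_apply, vecMul, dotProduct]

lemma groundState_mem_densityMatrices : groundState ∈ densityMatrices := by
  refine ⟨?_, by simp [groundState]⟩
  have : groundState = vecMulVec ![1, 0] (star ![1, 0]) := by
    ext i j
    fin_cases i <;> fin_cases j <;> simp [groundState, vecMulVec_apply]
  rw [this]
  exact posSemidef_vecMulVec_self_star _

/-- Positivity of the determinant gives `|ρ 0 1|² ≤ ρ 0 0 * ρ 1 1 = 0`. -/
lemma eq_groundState {ρ : Mat2} (hρ : ρ ∈ densityMatrices) (h : ρ 1 1 = 0) : ρ = groundState := by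
  obtain ⟨hpos, htr⟩ := hρ
  have hdet := hpos.det_nonneg
  have h10 : ρ 1 0 = star (ρ 0 1) := (hpos.1.apply 1 0).symm
  rw [trace_fin_two, h, add_zero] at htr
  have h01 : ρ 0 1 = 0 := by
    rw [det_fin_two, h, h10, mul_zero, zero_sub, Complex.star_def, Complex.mul_conj] at hdet
    have : normSq (ρ 0 1) ≤ 0 := by
      have := (Complex.le_def.1 hdet).1
      simpa using this
    exact normSq_eq_zero.1 (le_antisymm this (normSq_nonneg _))
  ext i j
  fin_cases i <;> fin_cases j <;> simp [groundState, h, h01, h10, htr]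

lemma eq_unitaryConj_groundState {ρ : Mat2} (hρ : ρ ∈ densityMatrices) (h : ρ.det = 0) :
    ∃ U : unitaryGroup (Fin 2) ℂ, ρ = unitaryConj U groundState := by
  obtain ⟨U, a, ha, -, rfl⟩ := exists_eq_unitaryConj hρ
  rw [det_unitaryConj, det_fin_two_of, zero_mul, sub_zero, ← ofReal_mul, ofReal_eq_zero] at h
  have h1 : 1 - a = 0 := (mul_eq_zero.1 h).resolve_left ha.ne'
  have h2 : a = 1 := by linarith
  refine ⟨U, ?_⟩
  rw [h1, h2]
  simp [groundState]

lemma mem_pureStates_iff {ρ : Mat2} : ρ ∈ pureStates ↔ ρ ∈ densityMatrices ∧ ρ.det = 0 := by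
  refine and_congr_right fun hρ => ⟨fun h => ?_, fun h => ?_⟩
  · by_contra hd
    rw [rank_of_det_ne_zero hd] at h
    simp at h
  · obtain ⟨U, rfl⟩ := eq_unitaryConj_groundState hρ h
    have hU : ((U : Mat2)).det ≠ 0 := fun h0 => by
      have := congrArg Matrix.det (Unitary.coe_mul_star_self U)
      rw [det_mul, h0, zero_mul, det_one] at this
      exact zero_ne_one this
    have hU' : ((U : Mat2)ᴴ).det ≠ 0 := by rwa [det_conjTranspose, star_ne_zero]
    rw [unitaryConj_apply, rank_mul_eq_right_of_det_ne_zero _ _ hU,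
      rank_mul_eq_left_of_det_ne_zero _ _ hU']
    have : groundState = diagonal ![1, 0] := by
      ext i j
      fin_cases i <;> fin_cases j <;> simp [groundState]
    rw [this, rank_diagonal, Fintype.card_eq_one_iff]
    refine ⟨⟨0, by simp⟩, fun ⟨i, hi⟩ => ?_⟩
    fin_cases i
    · rfl
    · simp at hi

lemma unitaryConj_mem_pureStates (U : unitaryGroup (Fin 2) ℂ) {ρ : Mat2} (hρ : ρ ∈ pureStates) :
    unitaryConj U ρ ∈ pureStates := by
  rw [mem_pureStates_iff] at hρ ⊢
  exact ⟨map_mem_densityMatrices (unitaryConj_mem_channels U) hρ.1, by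
    rw [det_unitaryConj, hρ.2]⟩

lemma pureOutput_unitaryConj (U V : unitaryGroup (Fin 2) ℂ) (Φ : Mat2 →ₗ[ℂ] Mat2) :
    pureOutput (unitaryConj U ∘ₗ Φ ∘ₗ unitaryConj V) = unitaryConj U '' pureOutput Φ := by
  ext ξ
  constructor
  · rintro ⟨⟨ρ, hρ, rfl⟩, hξ⟩
    refine ⟨Φ (unitaryConj V ρ),
      ⟨⟨_, map_mem_densityMatrices (unitaryConj_mem_channels V) hρ, rfl⟩, ?_⟩, rfl⟩
    have := unitaryConj_mem_pureStates (star U) hξ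
    simpa [unitaryConj_star_apply] using this
  · rintro ⟨-, ⟨⟨ρ, hρ, rfl⟩, hξ⟩, rfl⟩
    refine ⟨⟨unitaryConj (star V) ρ,
      map_mem_densityMatrices (unitaryConj_mem_channels _) hρ, ?_⟩, unitaryConj_mem_pureStates U hξ⟩
    simp [unitaryConj_apply_star]

/-- Composing with unitary conjugations is an affine bijection of the set of channels. -/
lemma IsExtremal.unitaryConj_comp_comp {Φ : Mat2 →ₗ[ℂ] Mat2} (hΦ : IsExtremal Φ)
    (U V : unitaryGroup (Fin 2) ℂ) : IsExtremal (unitaryConj U ∘ₗ Φ ∘ₗ unitaryConj V) := by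
  rw [IsExtremal, mem_extremePoints_iff_left] at hΦ ⊢
  refine ⟨comp_mem_channels (unitaryConj_mem_channels U)
    (comp_mem_channels hΦ.1 (unitaryConj_mem_channels V)), ?_⟩
  rintro Ψ hΨ Ψ' hΨ' ⟨a, b, ha, hb, hab, h⟩
  have hmem {Θ : Mat2 →ₗ[ℂ] Mat2} (hΘ : Θ ∈ channels) :
      unitaryConj (star U) ∘ₗ Θ ∘ₗ unitaryConj (star V) ∈ channels :=
    comp_mem_channels (unitaryConj_mem_channels _)
      (comp_mem_channels hΘ (unitaryConj_mem_channels _))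
  have := hΦ.2 _ (hmem hΨ) _ (hmem hΨ') ⟨a, b, ha, hb, hab, by
    ext1 X
    have h' := congrArg (unitaryConj (star U)) (LinearMap.congr_fun h (unitaryConj (star V) X))
    simpa [unitaryConj_star_apply, unitaryConj_apply_star] using h'⟩
  rw [← this]
  ext1 X
  simp [unitaryConj_star_apply, unitaryConj_apply_star]

/-! ### The matrix in the Pauli basis -/

lemma pauli_expansion (X : Mat2) : X = ∑ k, ((pauli k * X).trace / 2) • pauli k := by
  ext i j
  fin_cases i <;> fin_cases j <;>
    simp [pauli, Fin.sum_univ_four, trace_fin_two, Matrix.mul_apply, Fin.sum_univ_two] <;>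
    ring_nf <;> simp <;> ring

lemma isHermitian_pauli (k : Fin 4) : (pauli k).IsHermitian := by
  fin_cases k <;> ext i j <;> fin_cases i <;> fin_cases j <;> simp [pauli]

/-- The trace is its own conjugate because a channel preserves Hermitian matrices. -/
lemma ofReal_blochMatrix {Φ : Mat2 →ₗ[ℂ] Mat2} (hΦ : Φ ∈ channels) (i j : Fin 4) :
    (blochMatrix Φ i j : ℂ) = (pauli i * Φ (pauli j)).trace / 2 := by
  have h : star (pauli i * Φ (pauli j)).trace = (pauli i * Φ (pauli j)).trace := by
    rw [← trace_conjTranspose, conjTranspose_mul, ← hΦ.1.map_conjTranspose,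
      (isHermitian_pauli i).eq, (isHermitian_pauli j).eq, trace_mul_comm]
  have := Complex.conj_eq_iff_re.1 h
  simp only [blochMatrix, Matrix.of_apply]
  push_cast
  rw [this]

lemma pauli_trace_map {Φ : Mat2 →ₗ[ℂ] Mat2} (hΦ : Φ ∈ channels) (X : Mat2) (i : Fin 4) :
    (pauli i * Φ X).trace / 2 =
      ∑ k, (blochMatrix Φ i k : ℂ) * ((pauli k * X).trace / 2) := by
  conv_lhs => rw [pauli_expansion X]
  simp only [map_sum, map_smul, Matrix.mul_sum, trace_sum, Finset.sum_div, Matrix.mul_smul,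
    trace_smul, smul_eq_mul]
  refine Finset.sum_congr rfl fun k _ => ?_
  rw [ofReal_blochMatrix hΦ]
  ring

lemma blochMatrix_comp {Φ Ψ : Mat2 →ₗ[ℂ] Mat2} (hΦ : Φ ∈ channels) (hΨ : Ψ ∈ channels) :
    blochMatrix (Φ ∘ₗ Ψ) = blochMatrix Φ * blochMatrix Ψ := by
  ext i j
  apply Complex.ofReal_injective
  rw [ofReal_blochMatrix (comp_mem_channels hΦ hΨ), LinearMap.comp_apply, pauli_trace_map hΦ,
    Matrix.mul_apply]
  push_cast
  simp only [ofReal_blochMatrix hΨ]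

lemma IsNondegenerate.of_comp {Φ Ψ : Mat2 →ₗ[ℂ] Mat2} (hΦ : Φ ∈ channels) (hΨ : Ψ ∈ channels)
    (h : IsNondegenerate (Φ ∘ₗ Ψ)) : IsNondegenerate Φ ∧ IsNondegenerate Ψ := by
  rw [IsNondegenerate, blochMatrix_comp hΦ hΨ, det_mul] at h
  exact ⟨left_ne_zero_of_mul h, right_ne_zero_of_mul h⟩

lemma IsNondegenerate.injective {Φ : Mat2 →ₗ[ℂ] Mat2} (hΦ : Φ ∈ channels)
    (h : IsNondegenerate Φ) : Function.Injective Φ := by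
  rw [injective_iff_map_eq_zero]
  intro X hX
  have hdet : ((blochMatrix Φ).map Complex.ofRealHom).det ≠ 0 := by
    rw [← RingHom.mapMatrix_apply, ← RingHom.map_det]
    exact Complex.ofReal_ne_zero.2 h
  have h0 := eq_zero_of_mulVec_eq_zero hdet (v := fun k => (pauli k * X).trace / 2) <| by
    ext i
    have := pauli_trace_map hΦ X i
    rw [hX] at this
    simpa [mulVec, dotProduct] using this.symm
  rw [pauli_expansion X]
  exact Finset.sum_eq_zero fun k _ => by rw [congr_fun h0 k]; simp

/-! ### Channels that fix the ground state -/

/-- The general form of a channel that fixes the ground state. -/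
noncomputable def fixing (c q : ℂ) (p : ℝ) : Mat2 →ₗ[ℂ] Mat2 where
  toFun X := !![X 0 0 + p * X 1 1, c * X 0 1 + q * X 1 1;
    star c * X 1 0 + star q * X 1 1, (1 - p) * X 1 1]
  map_add' X Y := by
    ext i j
    fin_cases i <;> fin_cases j <;> simp <;> ring
  map_smul' a X := by
    ext i j
    fin_cases i <;> fin_cases j <;> simp <;> ring

lemma fixing_apply (c q : ℂ) (p : ℝ) (X : Mat2) : fixing c q p X =
    !![X 0 0 + p * X 1 1, c * X 0 1 + q * X 1 1;
      star c * X 1 0 + star q * X 1 1, (1 - p) * X 1 1] := rfl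

/-- The amplitude damping channel. -/
noncomputable abbrev damping (c : ℂ) : Mat2 →ₗ[ℂ] Mat2 := fixing c 0 (1 - normSq c)

lemma fixing_groundState (c q : ℂ) (p : ℝ) : fixing c q p groundState = groundState := by
  simp [fixing_apply, groundState]

/-- The Choi matrix has a zero diagonal entry at `(1, 0)`. What remains is the block with rows `(1,
0, c)`, `(0, p, q)`, `(star c, star q, 1 - p)`, whose principal minors give the inequalities. -/
lemma exists_eq_fixing {Φ : Mat2 →ₗ[ℂ] Mat2} (hΦ : Φ ∈ channels)
    (h : Φ groundState = groundState) :
    ∃ (c q : ℂ) (p : ℝ), Φ = fixing c q p ∧ 0 ≤ p ∧ 0 ≤ 1 - p - normSq c ∧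
      normSq q ≤ p * (1 - p - normSq c) := by
  have hC := hΦ.1.choi_posSemidef
  have hg : groundState = Matrix.single 0 0 1 := by
    ext i j
    fin_cases i <;> fin_cases j <;> simp [groundState, Matrix.single]
  have hstar (k l i j : Fin 2) :
      Φ (Matrix.single l k 1) j i = star (Φ (Matrix.single k l 1) i j) :=
    (hC.1.apply (j, l) (i, k)).symm
  have h00 : Φ (Matrix.single 0 0 1) = groundState := by rw [← hg, h]
  have htr01 : Φ (Matrix.single 0 1 1) 0 0 + Φ (Matrix.single 0 1 1) 1 1 = 0 := by
    have := hΦ.2 (Matrix.single 0 1 1)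
    rw [trace_fin_two] at this
    simpa [trace_fin_two, Matrix.single] using this
  have htr11 : Φ (Matrix.single 1 1 1) 0 0 + Φ (Matrix.single 1 1 1) 1 1 = 1 := by
    have := hΦ.2 (Matrix.single 1 1 1)
    rw [trace_fin_two] at this
    simpa [trace_fin_two, Matrix.single] using this
  -- a vanishing diagonal entry of the Choi matrix forces its row to vanish
  have hrow (j : Fin 2) : Φ (Matrix.single 0 1 1) 1 j = 0 := by
    have hdet := (hC.submatrix ![((1 : Fin 2), (0 : Fin 2)), (j, 1)]).det_nonneg
    rw [det_fin_two] at hdet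
    simp only [submatrix_apply, choi, Matrix.of_apply, cons_val_zero, cons_val_one, h00,
      hstar 0 1 1 j] at hdet
    simp only [groundState, of_apply, cons_val', cons_val_one, cons_val_fin_one, zero_mul,
      zero_sub, Complex.star_def, Complex.mul_conj] at hdet
    have : normSq (Φ (Matrix.single 0 1 1) 1 j) ≤ 0 := by
      have := (Complex.le_def.1 hdet).1
      simpa using this
    exact normSq_eq_zero.1 (le_antisymm this (normSq_nonneg _))
  rw [hrow 1, add_zero] at htr01
  set c := Φ (Matrix.single 0 1 1) 0 1 with hc
  set q := Φ (Matrix.single 1 1 1) 0 1 with hq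
  obtain ⟨p, hp0, hp⟩ : ∃ p : ℝ, 0 ≤ p ∧ Φ (Matrix.single 1 1 1) 0 0 = p := by
    have h0 : 0 ≤ Φ (Matrix.single 1 1 1) 0 0 := hC.diag_nonneg (i := (0, 1))
    exact ⟨_, (Complex.le_def.1 h0).1, Complex.eq_re_of_ofReal_le h0⟩
  have hp1 : Φ (Matrix.single 1 1 1) 1 1 = 1 - p := by
    rw [hp] at htr11
    exact eq_sub_of_add_eq' htr11
  refine ⟨c, q, p, ?_, hp0, ?_, ?_⟩
  · ext1 X
    rw [apply_eq_sum, fixing_apply]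
    simp only [Fin.sum_univ_two, h00]
    ext i j
    fin_cases i <;> fin_cases j <;>
      simp [groundState, hrow, htr01, hp, hp1, hstar 0 1, hstar 1 1 0 1, ← hc, ← hq, mul_comm]
  · have hdet := (hC.submatrix ![((0 : Fin 2), (0 : Fin 2)), (1, 1)]).det_nonneg
    rw [det_fin_two] at hdet
    simp only [submatrix_apply, choi, Matrix.of_apply, cons_val_zero, cons_val_one, h00,
      hstar 0 1 0 1, ← hc, hp1] at hdet
    simp only [groundState, of_apply, cons_val', cons_val_zero, cons_val_fin_one, one_mul,
      Complex.star_def, Complex.mul_conj] at hdet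
    exact_mod_cast hdet
  · have hdet := (hC.submatrix ![((0 : Fin 2), (0 : Fin 2)), (0, 1), (1, 1)]).det_nonneg
    rw [det_fin_three] at hdet
    simp only [submatrix_apply, choi, Matrix.of_apply, cons_val_zero, cons_val_one, cons_val, h00,
      hstar 0 1 0 1, hstar 0 1 0 0, hstar 1 1 0 1, ← hc, ← hq, hp, hp1, htr01] at hdet
    simp only [groundState, of_apply, cons_val', cons_val_zero, cons_val_fin_one, star_zero]
      at hdet
    have : (0 : ℂ) ≤ ((p * (1 - p - normSq c) - normSq q : ℝ) : ℂ) := by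
      convert hdet using 1
      push_cast
      rw [← Complex.mul_conj, ← Complex.mul_conj]
      simp only [Complex.star_def]
      ring
    have := Complex.zero_le_real.1 this
    linarith

lemma fixing_mem_channels {c q : ℂ} {p : ℝ} (hp : 0 ≤ p) (hr : 0 ≤ 1 - p - normSq c)
    (hq : normSq q ≤ p * (1 - p - normSq c)) : fixing c q p ∈ channels := by
  refine ⟨?_, fun X => by simp [fixing_apply, trace_fin_two]; ring⟩
  -- The Kraus operators below come from the Cholesky factorisation of the Choi matrix. If `p = 0`,
  -- then `q = 0` and the quotients by zero take the value zero, as needed.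
  set s : ℝ := √p
  set t : ℝ := √(1 - p - normSq c - normSq q / p)
  have hs : s * s = p := Real.mul_self_sqrt hp
  have ht : t * t = 1 - p - normSq c - normSq q / p := by
    refine Real.mul_self_sqrt (sub_nonneg.2 ?_)
    rcases hp.eq_or_lt with rfl | hp
    · simpa using hr
    · rwa [div_le_iff₀' hp]
  have hqp : s * (q / s) = q := by
    rcases hp.eq_or_lt with h0 | h0
    · have : normSq q = 0 := le_antisymm (by rw [← h0, zero_mul] at hq; exact hq) (normSq_nonneg _)
      simp [normSq_eq_zero.1 this]
    · have : (s : ℂ) ≠ 0 := by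
        rw [Complex.ofReal_ne_zero]
        exact (Real.sqrt_pos.2 h0).ne'
      field_simp
  have hqq : (q / s) * star (q / s) = ((normSq q / p : ℝ) : ℂ) := by
    rw [Complex.star_def, Complex.mul_conj, normSq_div, normSq_ofReal, hs]
  have hqp' : s * star (q / s) = star q := by
    have := congrArg star hqp
    rwa [star_mul', Complex.star_def, conj_ofReal] at this
  have hcc : c * star c = normSq c := Complex.mul_conj c
  have hsC : (s : ℂ) * s = p := by exact_mod_cast hs
  have htC : (t : ℂ) * t = 1 - p - normSq c - (normSq q / p : ℝ) := by exact_mod_cast ht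
  have : fixing c q p = krausMap !![1, 0; 0, star c] +
      (krausMap !![0, (s : ℂ); 0, star (q / s)] + krausMap !![0, 0; 0, (t : ℂ)]) := by
    ext X i j
    generalize hw : q / (s : ℂ) = w at *
    simp only [Complex.star_def] at *
    fin_cases i <;> fin_cases j <;>
      simp [fixing_apply, krausMap_apply, Matrix.mul_apply, vecMul, dotProduct]
    · linear_combination (-X 1 1) * hsC
    · linear_combination (-X 1 1) * hqp
    · linear_combination (-X 1 1) * hqp'
    · linear_combination (-X 1 1) * (hcc + hqq + htC)
  rw [this]
  exact (isCompletelyPositive_krausMap _).add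
    ((isCompletelyPositive_krausMap _).add (isCompletelyPositive_krausMap _))

lemma damping_mem_channels {c : ℂ} (hc : normSq c ≤ 1) : damping c ∈ channels :=
  fixing_mem_channels (by linarith) (by simp) (by simp)

lemma fixing_injective_params {c c' q q' : ℂ} {p p' : ℝ} (h : fixing c q p = fixing c' q' p') :
    c = c' ∧ q = q' ∧ p = p' := by
  have h1 := LinearMap.congr_fun h (!![0, 1; 0, 0] : Mat2)
  have h2 := LinearMap.congr_fun h (!![0, 0; 0, 1] : Mat2)
  rw [fixing_apply, fixing_apply] at h1 h2
  refine ⟨?_, ?_, ?_⟩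
  · simpa using congr_fun₂ h1 0 1
  · simpa using congr_fun₂ h2 0 1
  · simpa using congr_fun₂ h2 0 0

/-! ### Extremality and pure outputs -/

/-- The ground state is an extreme point of the states. Two channels serve `isExtremal_damping`, two
states serve `det_eq_zero_of_map`. -/
lemma map_groundState_of_combo {Ψ Ψ' : Mat2 →ₗ[ℂ] Mat2} (hΨ : Ψ ∈ channels)
    (hΨ' : Ψ' ∈ channels) {ρ ρ' : Mat2} (hρ : ρ ∈ densityMatrices) (hρ' : ρ' ∈ densityMatrices)
    {a b : ℝ} (ha : 0 < a) (hb : 0 < b) (h : a • Ψ ρ + b • Ψ' ρ' = groundState) :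
    Ψ ρ = groundState ∧ Ψ' ρ' = groundState := by
  have h1 := map_mem_densityMatrices hΨ hρ
  have h2 := map_mem_densityMatrices hΨ' hρ'
  have h3 : 0 ≤ Ψ ρ 1 1 := h1.1.diag_nonneg
  have h4 : 0 ≤ Ψ' ρ' 1 1 := h2.1.diag_nonneg
  have h5 : a • Ψ ρ 1 1 + b • Ψ' ρ' 1 1 = 0 := congr_fun₂ h 1 1
  rw [add_eq_zero_iff_of_nonneg (smul_nonneg ha.le h3) (smul_nonneg hb.le h4)] at h5
  exact ⟨eq_groundState h1 ((smul_eq_zero_iff_right ha.ne').1 h5.1),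
    eq_groundState h2 ((smul_eq_zero_iff_right hb.ne').1 h5.2)⟩

/-- The defect `1 - p - |c|²` is strictly concave in `c`, nonnegative on both components and zero on
their mixture. So the components share `c` and have zero defect, which forces `q = 0`. -/
lemma isExtremal_damping {c : ℂ} (hc : normSq c ≤ 1) : IsExtremal (damping c) := by
  rw [IsExtremal, mem_extremePoints_iff_left]
  refine ⟨damping_mem_channels hc, ?_⟩
  rintro Ψ hΨ Ψ' hΨ' ⟨a, b, ha, hb, hab, h⟩
  have hg := groundState_mem_densityMatrices
  have h0 : a • Ψ groundState + b • Ψ' groundState = groundState := by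
    have := LinearMap.congr_fun h groundState
    rwa [fixing_groundState] at this
  obtain ⟨hf, hf'⟩ := map_groundState_of_combo hΨ hΨ' hg hg ha hb h0
  obtain ⟨c₁, q₁, p₁, rfl, hp₁, hr₁, hq₁⟩ := exists_eq_fixing hΨ hf
  obtain ⟨c₂, q₂, p₂, rfl, hp₂, hr₂, hq₂⟩ := exists_eq_fixing hΨ' hf'
  have hlin : fixing (a * c₁ + b * c₂) (a * q₁ + b * q₂) (a * p₁ + b * p₂) = damping c := by
    rw [← h]
    ext X i j
    have habC : (a : ℂ) + b = 1 := by exact_mod_cast hab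
    fin_cases i <;> fin_cases j <;> simp [fixing_apply]
    · linear_combination (-X 0 0) * habC
    · ring
    · ring
    · linear_combination (-X 1 1) * habC
  obtain ⟨hcc, -, hpp⟩ := fixing_injective_params hlin
  have hconv : normSq c = a * normSq c₁ + b * normSq c₂ - a * b * normSq (c₁ - c₂) := by
    rw [← hcc, eq_sub_of_add_eq' hab]
    simp [normSq_apply]
    ring
  have hab0 : 0 < a * b := mul_pos ha hb
  have hn := normSq_nonneg (c₁ - c₂)
  have e1 := mul_nonneg ha.le hr₁
  have e2 := mul_nonneg hb.le hr₂
  have e3 := mul_nonneg hab0.le hn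
  have e0 : a * (1 - p₁ - normSq c₁) + b * (1 - p₂ - normSq c₂) + a * b * normSq (c₁ - c₂) = 0 := by
    linear_combination hab - hpp + hconv
  have hr₁0 : 1 - p₁ - normSq c₁ = 0 :=
    (mul_eq_zero.1 (by linarith : a * (1 - p₁ - normSq c₁) = 0)).resolve_left ha.ne'
  have hcd : c₁ = c₂ := sub_eq_zero.1 <| normSq_eq_zero.1 <|
    (mul_eq_zero.1 (by linarith : a * b * normSq (c₁ - c₂) = 0)).resolve_left hab0.ne'
  have hc1 : c₁ = c := by
    have habC : (a : ℂ) + b = 1 := by exact_mod_cast hab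
    rw [← hcc, ← hcd]
    linear_combination (-c₁) * habC
  have hq1 : q₁ = 0 := normSq_eq_zero.1 <|
    le_antisymm (by rw [hr₁0, mul_zero] at hq₁; exact hq₁) (normSq_nonneg _)
  rw [hq1, hc1, damping, ← hc1]
  congr 1
  linarith

lemma pureOutput_damping {c : ℂ} (hc0 : c ≠ 0) (hc : normSq c < 1) :
    pureOutput (damping c) = {groundState} := by
  have hg := groundState_mem_densityMatrices
  refine Set.eq_singleton_iff_unique_mem.2
    ⟨⟨⟨_, hg, fixing_groundState _ _ _⟩, mem_pureStates_iff.2 ⟨hg, by simp [groundState]⟩⟩, ?_⟩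
  rintro - ⟨⟨ρ, hρ, rfl⟩, hpure⟩
  suffices h : ρ 1 1 = 0 by rw [eq_groundState hρ h, fixing_groundState]
  obtain ⟨-, hdet⟩ := mem_pureStates_iff.1 hpure
  have h1 := hρ.1.det_nonneg
  have h2 : 0 ≤ ρ 1 1 := hρ.1.diag_nonneg
  obtain ⟨d, hd⟩ : ∃ d : ℝ, ρ.det = d := ⟨_, Complex.eq_re_of_ofReal_le h1⟩
  obtain ⟨x, hx⟩ : ∃ x : ℝ, ρ 1 1 = x := ⟨_, Complex.eq_re_of_ofReal_le h2⟩
  rw [hd, Complex.zero_le_real] at h1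
  have hcc : c * star c = normSq c := Complex.mul_conj c
  -- The left side is the determinant of the output, a positive multiple of a sum of two nonnegative
  -- terms.
  have key : normSq c * (d + (1 - normSq c) * x ^ 2) = 0 := by
    rw [det_fin_two] at hd
    rw [damping, fixing_apply, det_fin_two_of, hx] at hdet
    rw [hx] at hd
    apply Complex.ofReal_injective
    push_cast at hdet ⊢
    rw [← hd]
    simp only [star_zero] at hdet
    linear_combination hdet + ρ 0 1 * ρ 1 0 * hcc
  have hc0' : 0 < normSq c := normSq_pos.2 hc0
  have h3 := (mul_eq_zero.1 key).resolve_left hc0'.ne'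
  have h4 : 0 ≤ (1 - normSq c) * x ^ 2 := mul_nonneg (by linarith) (sq_nonneg x)
  have h5 : (1 - normSq c) * x ^ 2 = 0 := by linarith
  have h6 := (mul_eq_zero.1 h5).resolve_left (by linarith)
  rw [hx, pow_eq_zero_iff two_ne_zero |>.1 h6, ofReal_zero]

/-- The matrix `k • v vᴴ` with `v = (a, b)`. -/
noncomputable def weightedProj (k : ℝ) (a b : ℂ) : Mat2 :=
  !![k * (a * star a), k * (a * star b); k * (b * star a), k * (b * star b)]

lemma weightedProj_mem_densityMatrices {k : ℝ} (hk : 0 ≤ k) {a b : ℂ}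
    (h : k * (normSq a + normSq b) = 1) : weightedProj k a b ∈ densityMatrices := by
  constructor
  · have : weightedProj k a b = (k : ℂ) • vecMulVec ![a, b] (star ![a, b]) := by
      ext i j
      rw [Matrix.smul_apply, vecMulVec_apply]
      fin_cases i <;> fin_cases j <;> rfl
    rw [this]
    exact (posSemidef_vecMulVec_self_star _).smul (Complex.zero_le_real.2 hk)
  · simp only [weightedProj, trace_fin_two_of, Complex.star_def, Complex.mul_conj]
    rw [← mul_add]
    exact_mod_cast h

/-- An extremal channel that fixes the ground state and has no further pure output is an amplitude
damping channel. -/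
lemma eq_one_sub_normSq_of_isExtremal {c q : ℂ} {p : ℝ} (hp : 0 ≤ p) (hr : 0 ≤ 1 - p - normSq c)
    (hq : normSq q ≤ p * (1 - p - normSq c)) (hext : IsExtremal (fixing c q p))
    (hpure : pureOutput (fixing c q p) = {groundState}) : p = 1 - normSq c := by
  by_contra hne
  have hr0 : 0 < 1 - p - normSq c := lt_of_le_of_ne hr fun h => hne (by linarith)
  set r := 1 - p - normSq c with hrdef
  rcases hq.lt_or_eq with hlt | heq
  · -- perturb `q`
    obtain ⟨ε, hε, hε'⟩ : ∃ ε : ℝ, 0 < ε ∧ ∀ x : ℝ, |x| = ε → normSq (q + x) ≤ p * r := by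
      have hcont : Filter.Tendsto (fun x : ℝ => normSq (q + x)) (nhds 0) (nhds (normSq q)) := by
        have : Continuous fun x : ℝ => normSq (q + x) := by fun_prop
        simpa using this.tendsto 0
      obtain ⟨δ, hδ, hδ'⟩ := Metric.eventually_nhds_iff.1 (hcont.eventually_lt_const hlt)
      refine ⟨δ / 2, half_pos hδ, fun x hx => (hδ' ?_).le⟩
      rw [Real.dist_eq, sub_zero, hx]
      exact half_lt_self hδ
    rw [IsExtremal, mem_extremePoints_iff_left] at hext
    have := hext.2 _ (fixing_mem_channels hp hr (hε' ε (abs_of_pos hε)))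
      _ (fixing_mem_channels hp hr (hε' (-ε) (by rw [abs_neg, abs_of_pos hε])))
      ⟨1 / 2, 1 / 2, by norm_num, by norm_num, by norm_num, by
        ext X i j
        fin_cases i <;> fin_cases j <;> simp [fixing_apply] <;> ring⟩
    have h2 := (fixing_injective_params this).2.1
    rw [add_eq_left, ofReal_eq_zero] at h2
    exact hε.ne' h2
  · -- a second pure output
    have hn : 0 < r * (1 - p) * (p + r) := by
      have : 0 < 1 - p := by linarith [normSq_nonneg c]
      positivity
    -- `n` is the squared norm of the input vector `(star c * q, r)`.
    set n := r * (1 - p) * (p + r) with hndef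
    have hqq : q * star q = p * r := by
      rw [Complex.star_def, Complex.mul_conj, heq]; push_cast; ring
    have hcc : c * star c = 1 - p - r := by
      rw [Complex.star_def, Complex.mul_conj, hrdef]; push_cast; ring
    have hn' : (n : ℂ) ≠ 0 := ofReal_ne_zero.2 hn.ne'
    -- For `p > 0` equality leaves two Kraus operators, and this input makes their images parallel.
    -- For `p = 0` it is the second basis state, which is then fixed.
    have hout : fixing c q p (weightedProj (1 / n) (star c * q) r) =
        weightedProj ((1 - p) / n) q r := by
      simp only [Complex.star_def] at hqq hcc
      ext i j
      fin_cases i <;> fin_cases j <;> simp [fixing_apply, weightedProj] <;> field_simp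
      · linear_combination (c * (starRingEnd ℂ) c) * hqq + p * r * hcc - (1 - p) * hqq
      · linear_combination q * hcc
      · linear_combination (starRingEnd ℂ) q * hcc
    have hin : weightedProj (1 / n) (star c * q) r ∈ densityMatrices := by
      refine weightedProj_mem_densityMatrices (by positivity) ?_
      rw [normSq_mul, Complex.star_def, normSq_conj, normSq_ofReal, heq, div_mul_eq_mul_div, div_eq_one_iff_eq hn.ne', hndef]
      have : normSq c = 1 - p - r := by rw [hrdef]; ring
      rw [this]
      ring
    have hmem : weightedProj ((1 - p) / n) q r ∈ pureOutput (fixing c q p) := by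
      rw [← hout]
      refine ⟨⟨_, hin, rfl⟩, mem_pureStates_iff.2 ⟨map_mem_densityMatrices hext.1 hin, ?_⟩⟩
      rw [hout, weightedProj, det_fin_two_of]
      ring
    rw [hpure, Set.mem_singleton_iff] at hmem
    have h11 : (((1 - p) / n : ℝ) : ℂ) * (r * star (r : ℂ)) = 0 := congr_fun₂ hmem 1 1
    have h1p : 0 < 1 - p := by linarith [normSq_nonneg c]
    rw [Complex.star_def, conj_ofReal, ← ofReal_mul, ← ofReal_mul, ofReal_eq_zero] at h11
    exact (mul_pos (div_pos h1p hn) (mul_pos hr0 hr0)).ne' h11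

/-! ### Reduction to the normal form -/

lemma exists_diagonal_unitary {u : ℂ} (hu : normSq u = 1) :
    ∃ U : unitaryGroup (Fin 2) ℂ, (U : Mat2) = !![1, 0; 0, star u] := by
  have h : u * (starRingEnd ℂ) u = 1 := by rw [Complex.mul_conj, hu, ofReal_one]
  refine ⟨⟨!![1, 0; 0, star u], ?_⟩, rfl⟩
  rw [mem_unitaryGroup_iff]
  ext i j
  fin_cases i <;> fin_cases j <;>
    simp [Matrix.mul_apply, Matrix.star_apply, mul_comm _ u, h]

/-- A diagonal unitary absorbs the phase of the parameter. -/
lemma damping_mul {u : ℂ} (hu : normSq u = 1) (c : ℂ) :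
    ∃ U : unitaryGroup (Fin 2) ℂ, damping (u * c) = unitaryConj U ∘ₗ damping c := by
  obtain ⟨U, hU⟩ := exists_diagonal_unitary hu
  have h : u * (starRingEnd ℂ) u = 1 := by rw [Complex.mul_conj, hu, ofReal_one]
  refine ⟨U, ?_⟩
  ext X i j
  rw [LinearMap.comp_apply, unitaryConj_apply, hU, damping, damping, normSq_mul, hu, one_mul]
  fin_cases i <;> fin_cases j <;>
    simp [fixing_apply, Matrix.mul_apply, vecMul, dotProduct]
  · ring
  · ring
  · linear_combination (-(normSq c : ℂ) * X 1 1) * h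

lemma damping_one : damping 1 = LinearMap.id := by
  ext X i j
  fin_cases i <;> fin_cases j <;> simp [fixing_apply]

lemma blochMatrix_damping (l : ℝ) : blochMatrix (damping (l : ℂ)) = onePOMatrix l := by
  ext i j
  fin_cases i <;> fin_cases j <;>
    simp [blochMatrix, onePOMatrix, pauli, fixing_apply, trace_fin_two, Matrix.mul_apply] <;> ring

lemma isUnitaryConj_damping {c : ℂ} (hc : normSq c = 1) : IsUnitaryConj (damping c) := by
  obtain ⟨U, hU⟩ := damping_mul hc 1
  refine ⟨U, ?_⟩
  rwa [mul_one, damping_one, LinearMap.comp_id] at hU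

lemma IsUnitaryConj.comp {Φ Ψ : Mat2 →ₗ[ℂ] Mat2} (hΦ : IsUnitaryConj Φ) (hΨ : IsUnitaryConj Ψ) :
    IsUnitaryConj (Φ ∘ₗ Ψ) := by
  obtain ⟨U, rfl⟩ := hΦ
  obtain ⟨V, rfl⟩ := hΨ
  exact ⟨U * V, unitaryConj_comp U V⟩

/-- A unitary conjugation has distinct pure outputs on the two basis states. -/
lemma not_isUnitaryConj_of_pureOutput {Φ : Mat2 →ₗ[ℂ] Mat2} {ξ : Mat2}
    (h : pureOutput Φ = {ξ}) : ¬ IsUnitaryConj Φ := by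
  rintro ⟨U, rfl⟩
  have hsub {ρ : Mat2} (hρ : ρ ∈ pureStates) : unitaryConj U ρ = ξ := by
    have : unitaryConj U ρ ∈ pureOutput (unitaryConj U) :=
      ⟨⟨ρ, hρ.1, rfl⟩, unitaryConj_mem_pureStates U hρ⟩
    rwa [h] at this
  have h0 : weightedProj 1 1 0 ∈ pureStates := mem_pureStates_iff.2
    ⟨weightedProj_mem_densityMatrices zero_le_one (by simp), by simp [weightedProj]⟩
  have h1 : weightedProj 1 0 1 ∈ pureStates := mem_pureStates_iff.2
    ⟨weightedProj_mem_densityMatrices zero_le_one (by simp), by simp [weightedProj]⟩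
  have := congrArg (unitaryConj (star U)) ((hsub h0).trans (hsub h1).symm)
  rw [unitaryConj_star_apply, unitaryConj_star_apply] at this
  simpa [weightedProj] using congr_fun₂ this 0 0

/-- Under an injective channel only pure states are mapped to a pure state. -/
lemma det_eq_zero_of_map {Φ : Mat2 →ₗ[ℂ] Mat2} (hΦ : Φ ∈ channels) (hinj : Function.Injective Φ)
    {ρ : Mat2} (hρ : ρ ∈ densityMatrices) (h : (Φ ρ).det = 0) : ρ.det = 0 := by
  obtain ⟨W, hW⟩ := eq_unitaryConj_groundState (map_mem_densityMatrices hΦ hρ) h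
  obtain ⟨V, a, ha, ha1, rfl⟩ := exists_eq_unitaryConj hρ
  rw [det_unitaryConj]
  rcases ha1.lt_or_eq with ha1 | rfl
  -- For `a < 1` the state is a proper mixture of two distinct pure states. A pure image forces
  -- their images to agree, against injectivity.
  · exfalso
    have h0 : weightedProj 1 1 0 ∈ densityMatrices :=
      weightedProj_mem_densityMatrices zero_le_one (by simp)
    have h1 : weightedProj 1 0 1 ∈ densityMatrices :=
      weightedProj_mem_densityMatrices zero_le_one (by simp)
    have hsplit : (!![(a : ℂ), 0; 0, ((1 - a : ℝ) : ℂ)] : Mat2) =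
        (a : ℂ) • weightedProj 1 1 0 + ((1 - a : ℝ) : ℂ) • weightedProj 1 0 1 := by
      ext i j
      fin_cases i <;> fin_cases j <;> simp [weightedProj]
    have hΨ : unitaryConj (star W) ∘ₗ Φ ∘ₗ unitaryConj V ∈ channels :=
      comp_mem_channels (unitaryConj_mem_channels _)
        (comp_mem_channels hΦ (unitaryConj_mem_channels _))
    obtain ⟨e0, e1⟩ := map_groundState_of_combo hΨ hΨ h0 h1 ha (sub_pos.2 ha1) (by
      have := congrArg (unitaryConj (star W)) hW
      rw [unitaryConj_star_apply, hsplit] at this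
      rw [← this]
      simp only [map_add, map_smul, LinearMap.comp_apply]
      rfl)
    have := (e0.trans e1.symm)
    simp only [LinearMap.comp_apply] at this
    have := congrArg (unitaryConj W) this
    rw [unitaryConj_apply_star, unitaryConj_apply_star] at this
    have := congrArg (unitaryConj (star V)) (hinj this)
    rw [unitaryConj_star_apply, unitaryConj_star_apply] at this
    simpa [weightedProj] using congr_fun₂ this 0 0
  · simp

/-- Up to unitary conjugations, `Φ` is an amplitude damping channel. -/
lemma classification_of_damping {Φ : Mat2 →ₗ[ℂ] Mat2} (hnd : IsNondegenerate Φ)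
    (U V : unitaryGroup (Fin 2) ℂ) {c : ℂ} (hc0 : c ≠ 0) (hc : normSq c ≤ 1)
    (h : Φ = unitaryConj U ∘ₗ damping c ∘ₗ unitaryConj V) :
    IsUnitaryConj Φ ∨ (IsNondegenerateExtremalOnePO Φ ∧ HasOnePONormalForm Φ) := by
  rcases hc.lt_or_eq with hc1 | hc1
  · refine Or.inr ⟨⟨?_, hnd, unitaryConj U groundState, ?_⟩, ?_⟩
    · rw [h]
      exact (isExtremal_damping hc).unitaryConj_comp_comp U V
    · rw [h, pureOutput_unitaryConj, pureOutput_damping hc0 hc1, Set.image_singleton]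
    · have hn0 : (‖c‖ : ℂ) ≠ 0 := by simpa using hc0
      obtain ⟨D, hD⟩ := damping_mul (u := c / ‖c‖) (by
        rw [normSq_div, normSq_ofReal, normSq_eq_norm_sq, sq, div_self]
        simpa using hc0) ‖c‖
      rw [div_mul_cancel₀ _ hn0] at hD
      rw [normSq_eq_norm_sq] at hc1
      refine ⟨U * D, V, ‖c‖, damping ‖c‖, damping_mem_channels ?_, norm_pos_iff.2 hc0,
        (sq_lt_one_iff₀ (norm_nonneg c)).1 hc1, blochMatrix_damping _, ?_⟩
      · rw [normSq_ofReal, ← sq]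
        exact hc1.le
      · rw [h, hD, ← unitaryConj_comp]
        rfl
  · left
    rw [h]
    exact IsUnitaryConj.comp ⟨U, rfl⟩ ((isUnitaryConj_damping hc1).comp ⟨V, rfl⟩)

lemma fixing_comp (c₁ c₂ q₁ q₂ : ℂ) (p₁ p₂ : ℝ) :
    fixing c₂ q₂ p₂ ∘ₗ fixing c₁ q₁ p₁ =
      fixing (c₂ * c₁) (c₂ * q₁ + q₂ * (1 - p₁)) (p₁ + p₂ * (1 - p₁)) := by
  ext X i j
  fin_cases i <;> fin_cases j <;> simp [fixing_apply] <;> ring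

end QubitChannel

/-! ### The factors of a composition -/

theorem proposition5p12
    (Φ Φ₁ Φ₂ : QubitChannel.Mat2 →ₗ[ℂ] QubitChannel.Mat2)
    (hΦ : QubitChannel.IsNondegenerateExtremalOnePO Φ)
    (hΦ₁ : Φ₁ ∈ QubitChannel.channels) (hΦ₂ : Φ₂ ∈ QubitChannel.channels)
    (hdecomp : Φ = Φ₂ ∘ₗ Φ₁) :
    (QubitChannel.IsUnitaryConj Φ₁ ∨
      (QubitChannel.IsNondegenerateExtremalOnePO Φ₁ ∧ QubitChannel.HasOnePONormalForm Φ₁)) ∧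
    (QubitChannel.IsUnitaryConj Φ₂ ∨
      (QubitChannel.IsNondegenerateExtremalOnePO Φ₂ ∧ QubitChannel.HasOnePONormalForm Φ₂)) ∧
    ¬ (QubitChannel.IsUnitaryConj Φ₁ ∧ QubitChannel.IsUnitaryConj Φ₂) := by
  open QubitChannel Complex in
  obtain ⟨hext, hnd, ξ, hξ⟩ := hΦ
  subst hdecomp
  obtain ⟨hnd₂, hnd₁⟩ := hnd.of_comp hΦ₂ hΦ₁
  have hξmem : ξ ∈ pureOutput (Φ₂ ∘ₗ Φ₁) := hξ ▸ Set.mem_singleton ξ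
  obtain ⟨⟨ρ, hρ, hρξ⟩, hpure⟩ := hξmem
  obtain ⟨hξd, hξ0⟩ := mem_pureStates_iff.1 hpure
  have hρ₁ := map_mem_densityMatrices hΦ₁ hρ
  have hdet₁ : (Φ₁ ρ).det = 0 := det_eq_zero_of_map hΦ₂ (hnd₂.injective hΦ₂) hρ₁ (by
    rw [← LinearMap.comp_apply, hρξ, hξ0])
  obtain ⟨V, hV⟩ :=
    eq_unitaryConj_groundState hρ (det_eq_zero_of_map hΦ₁ (hnd₁.injective hΦ₁) hρ hdet₁)
  obtain ⟨M, hM⟩ := eq_unitaryConj_groundState hρ₁ hdet₁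
  obtain ⟨W, hW⟩ := eq_unitaryConj_groundState hξd hξ0
  rw [LinearMap.comp_apply, hM, hW] at hρξ
  rw [hV] at hM
  have hmem {Θ : Mat2 →ₗ[ℂ] Mat2} (hΘ : Θ ∈ channels) (A B : Matrix.unitaryGroup (Fin 2) ℂ) :
      unitaryConj A ∘ₗ Θ ∘ₗ unitaryConj B ∈ channels :=
    comp_mem_channels (unitaryConj_mem_channels A)
      (comp_mem_channels hΘ (unitaryConj_mem_channels B))
  obtain ⟨c₁, q₁, p₁, h₁, hp₁, hr₁, hq₁⟩ := exists_eq_fixing (hmem hΦ₁ (star M) V) (by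
    simp [hM, unitaryConj_star_apply])
  obtain ⟨c₂, q₂, p₂, h₂, hp₂, hr₂, hq₂⟩ := exists_eq_fixing (hmem hΦ₂ (star W) M) (by
    simp [hρξ, unitaryConj_star_apply])
  have hback₁ : Φ₁ = unitaryConj M ∘ₗ fixing c₁ q₁ p₁ ∘ₗ unitaryConj (star V) := by
    rw [← h₁]
    ext1 X
    simp [unitaryConj_apply_star]
  have hback₂ : Φ₂ = unitaryConj W ∘ₗ fixing c₂ q₂ p₂ ∘ₗ unitaryConj (star M) := by
    rw [← h₂]
    ext1 X
    simp [unitaryConj_apply_star]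
  have hcomp : unitaryConj (star W) ∘ₗ (Φ₂ ∘ₗ Φ₁) ∘ₗ unitaryConj V =
      fixing (c₂ * c₁) (c₂ * q₁ + q₂ * (1 - p₁)) (p₁ + p₂ * (1 - p₁)) := by
    rw [← fixing_comp, ← h₁, ← h₂]
    ext1 X
    simp [unitaryConj_apply_star]
  have hext' := hext.unitaryConj_comp_comp (star W) V
  have hpure' : pureOutput (unitaryConj (star W) ∘ₗ (Φ₂ ∘ₗ Φ₁) ∘ₗ unitaryConj V) =
      {groundState} := by
    rw [pureOutput_unitaryConj, hξ, Set.image_singleton, hW, unitaryConj_star_apply]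
  have hinj : Function.Injective (unitaryConj (star W) ∘ₗ (Φ₂ ∘ₗ Φ₁) ∘ₗ unitaryConj V) := by
    have hi (A : Matrix.unitaryGroup (Fin 2) ℂ) : Function.Injective (unitaryConj A) :=
      Function.LeftInverse.injective (unitaryConj_star_apply A)
    exact (hi _).comp (((hnd₂.injective hΦ₂).comp (hnd₁.injective hΦ₁)).comp (hi V))
  rw [hcomp] at hext' hpure' hinj
  -- With `c = 0` the matrix unit at `(0, 1)` would be mapped to zero.
  have hc0 : c₂ * c₁ ≠ 0 := fun h0 => by
    have := @hinj !![0, 1; 0, 0] 0 (by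
      rw [fixing_apply, h0, map_zero]
      ext i j
      fin_cases i <;> fin_cases j <;> simp)
    simpa using congr_fun₂ this 0 1
  have hc₁ : 0 < normSq c₁ := normSq_pos.2 (right_ne_zero_of_mul hc0)
  have hc₂ : 0 < normSq c₂ := normSq_pos.2 (left_ne_zero_of_mul hc0)
  obtain ⟨c, q, p, hf, hp, hr, hq⟩ := exists_eq_fixing hext'.1 (fixing_groundState _ _ _)
  obtain ⟨rfl, rfl, rfl⟩ := fixing_injective_params hf
  have key := eq_one_sub_normSq_of_isExtremal hp hr hq hext' hpure'
  rw [normSq_mul] at key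
  -- equality holds in `normSq cᵢ ≤ 1 - pᵢ`, because it holds for the products
  have e : (1 - p₂ - normSq c₂) * (1 - p₁) + normSq c₂ * (1 - p₁ - normSq c₁) = 0 := by
    linear_combination -key
  have hp₁' : 0 < 1 - p₁ := by linarith
  have f₁ := mul_nonneg hr₂ hp₁'.le
  have f₂ := mul_nonneg hc₂.le hr₁
  have hr₂0 : 1 - p₂ - normSq c₂ = 0 := (mul_eq_zero.1 (by linarith)).resolve_right hp₁'.ne'
  have hr₁0 : 1 - p₁ - normSq c₁ = 0 :=
    (mul_eq_zero.1 (by linarith : normSq c₂ * _ = 0)).resolve_left hc₂.ne'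
  have hq₁0 : q₁ = 0 := normSq_eq_zero.1 <|
    le_antisymm (by rwa [hr₁0, mul_zero] at hq₁) (normSq_nonneg _)
  have hq₂0 : q₂ = 0 := normSq_eq_zero.1 <|
    le_antisymm (by rwa [hr₂0, mul_zero] at hq₂) (normSq_nonneg _)
  rw [hq₁0, (by linarith : p₁ = 1 - normSq c₁)] at hback₁
  rw [hq₂0, (by linarith : p₂ = 1 - normSq c₂)] at hback₂
  exact ⟨classification_of_damping hnd₁ M (star V) (right_ne_zero_of_mul hc0) (by linarith) hback₁,
    classification_of_damping hnd₂ W (star M) (left_ne_zero_of_mul hc0) (by linarith) hback₂,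
    fun h => not_isUnitaryConj_of_pureOutput hξ (h.2.comp h.1)⟩
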